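/- Let $k\ge 1$. A \emph{semiweight} on $\mathbb{Z}_+^k$ is a function $\omega:\mathbb{Z}_+^k\to[0,\infty)$ with $\omega(0)=1$ and $\omega(M+N)\le\omega(M)\,\omega(N)$ for all $M,N\in\mathbb{Z}_+^k$; it is \emph{proper} if $\omega(N_0)=0$ for some $N_0\in\mathbb{N}^k$ (that is, a tuple with all entries positive). Let $\Omega=(\omega_m)$ be a sequence of proper semiweights on $\mathbb{Z}_+^k$ that is increasing ($\omega_m\le\omega_{m+1}$ pointwise for every $m$) and separating (for every $N\in\mathbb{Z}_+^k$ there is an $m$ with $\omega_m(N)\neq 0$). Let $$A=\ell^1(\mathbb{Z}_+^k,\Omega)=\Big\{\sum_{J}\lambda_JX^J\in\mathbb{C}[[X_1,\dots,X_k]]\ :\ p_m\Big(\sum_J\lambda_JX^J\Big):=\sum_J|\lambda_J|\,\omega_m(J)<\infty\ \text{for all } m\Big\}$$ be the corresponding Beurling–Fréchet algebra of semiweight type, with the topology $\tau$ defined by the seminorms $(p_m)$. Call a topology on a complex algebra a \emph{Fréchet algebra topology} if it is complete, metrizable and defined by an increasing sequence of submultiplicative seminorms. Then $A$ has a unique Fréchet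 algebra topology: $\tau$ is a Fréchet algebra topology on $A$, and every Fréchet algebra topology on $A$ is equal to $\tau$. -/

import Mathlib

/-- A topology `t` on a complex commutative unital algebra `A` is a Fréchet algebra topology if it
is metrizable, complete, and defined by an increasing sequence of submultiplicative seminorms. -/
structure IsFrechetAlgebraTopology (A : Type*) [CommRing A] [Algebra ℂ A]
    (t : TopologicalSpace A) : Prop where
  metrizable : TopologicalSpace.MetrizableSpace A
  complete : ∃ u : UniformSpace A, u.toTopologicalSpace = t ∧ IsUniformAddGroup A ∧ CompleteSpace A
  seminorms : ∃ p : SeminormFamily ℂ A ℕ, Monotone p ∧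
    (∀ m x y, p m (x * y) ≤ p m x * p m y) ∧ WithSeminorms p

/-- A semiweight function on the additive semigroup of `k`-tuples of non-negative integers. -/
structure IsSemiweight {k : ℕ} (ω : (Fin k →₀ ℕ) → ℝ) : Prop where
  nonneg : ∀ N, 0 ≤ ω N
  map_zero : ω 0 = 1
  map_add_le : ∀ M N, ω (M + N) ≤ ω M * ω N

/-- A semiweight is proper if it vanishes at some tuple of positive integers. -/
def IsProperSemiweight {k : ℕ} (ω : (Fin k →₀ ℕ) → ℝ) : Prop :=
  IsSemiweight ω ∧ ∃ N₀ : Fin k →₀ ℕ, (∀ i, 0 < N₀ i) ∧ ω N₀ = 0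

/-- A separating and increasing sequence of proper semiweights. -/
structure IsSemiweightTypeSequence {k : ℕ} (Ω : ℕ → (Fin k →₀ ℕ) → ℝ) : Prop where
  proper : ∀ m, IsProperSemiweight (Ω m)
  increasing : ∀ m N, Ω m N ≤ Ω (m + 1) N
  separating : ∀ N, ∃ m, Ω m N ≠ 0

/-- The Beurling–Fréchet algebra `ℓ¹(ℤ₊ᵏ, Ω)`: the formal power series `f = ∑ λ_J X^J` with
`∑ |λ_J| ω_m(J) < ∞` for all `m`, as a subalgebra of `ℂ[[X₁, …, X_k]]`. -/
def beurlingAlgebra {k : ℕ} (Ω : ℕ → (Fin k →₀ ℕ) → ℝ) (hΩ : ∀ m, IsSemiweight (Ω m)) :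
    Subalgebra ℂ (MvPowerSeries (Fin k) ℂ) where
  carrier := {f | ∀ m, Summable fun J => ‖MvPowerSeries.coeff J f‖ * Ω m J}
  add_mem' := by
    intro f g hf hg m
    refine ((hf m).add (hg m)).of_nonneg_of_le
      (fun J => mul_nonneg (norm_nonneg _) ((hΩ m).nonneg J)) (fun J => ?_)
    rw [← add_mul, map_add]
    exact mul_le_mul_of_nonneg_right (norm_add_le _ _) ((hΩ m).nonneg J)
  mul_mem' := by
    intro f g hf hg m
    have hn : ∀ (u : MvPowerSeries (Fin k) ℂ) J, 0 ≤ ‖MvPowerSeries.coeff J u‖ * Ω m J :=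
      fun u J => mul_nonneg (norm_nonneg _) ((hΩ m).nonneg J)
    have h2 : Summable fun x : (Fin k →₀ ℕ) × (Fin k →₀ ℕ) =>
        (‖MvPowerSeries.coeff x.1 f‖ * Ω m x.1) * (‖MvPowerSeries.coeff x.2 g‖ * Ω m x.2) :=
      Summable.mul_of_nonneg (f := fun J => ‖MvPowerSeries.coeff J f‖ * Ω m J)
        (g := fun J => ‖MvPowerSeries.coeff J g‖ * Ω m J) (hf m) (hg m) (hn f) (hn g)
    have h := summable_sum_mul_antidiagonal_of_summable_mul
      (f := fun J => ‖MvPowerSeries.coeff J f‖ * Ω m J)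
      (g := fun J => ‖MvPowerSeries.coeff J g‖ * Ω m J) h2
    refine h.of_nonneg_of_le
      (fun J => mul_nonneg (norm_nonneg _) ((hΩ m).nonneg J)) (fun J => ?_)
    rw [MvPowerSeries.coeff_mul]
    refine (mul_le_mul_of_nonneg_right (norm_sum_le _ _) ((hΩ m).nonneg J)).trans ?_
    rw [Finset.sum_mul]
    refine Finset.sum_le_sum fun p hp => ?_
    rw [← Finset.HasAntidiagonal.mem_antidiagonal.mp hp, norm_mul, mul_mul_mul_comm]
    exact mul_le_mul_of_nonneg_left ((hΩ m).map_add_le _ _)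
      (mul_nonneg (norm_nonneg _) (norm_nonneg _))
  algebraMap_mem' := by
    intro r m
    refine summable_of_ne_finset_zero (s := {0}) fun J hJ => ?_
    have hJ' : J ≠ 0 := by simpa using hJ
    simp [MvPowerSeries.algebraMap_apply, MvPowerSeries.coeff_C, hJ']

/-- The seminorm `p_m(f) = ∑ |λ_J| ω_m(J)` on `ℓ¹(ℤ₊ᵏ, Ω)`. -/
noncomputable def beurlingSeminorm {k : ℕ} (Ω : ℕ → (Fin k →₀ ℕ) → ℝ)
    (hΩ : ∀ m, IsSemiweight (Ω m)) : SeminormFamily ℂ (beurlingAlgebra Ω hΩ) ℕ := fun m =>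
  Seminorm.of
    (fun f => ∑' J, ‖MvPowerSeries.coeff J (f : MvPowerSeries (Fin k) ℂ)‖ * Ω m J)
    (by
      intro f g
      rw [← (f.2 m).tsum_add (g.2 m)]
      refine ((f + g).2 m).tsum_le_tsum (fun J => ?_) ((f.2 m).add (g.2 m))
      rw [← add_mul]
      exact mul_le_mul_of_nonneg_right (norm_add_le _ _) ((hΩ m).nonneg J))
    (by
      intro a f
      rw [← tsum_mul_left]
      refine tsum_congr fun J => ?_
      rw [← mul_assoc, ← norm_mul]
      rfl)

/-- The topology of `ℓ¹(ℤ₊ᵏ, Ω)` defined by the seminorms `p_m`. -/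
noncomputable abbrev beurlingTopology {k : ℕ} (Ω : ℕ → (Fin k →₀ ℕ) → ℝ)
    (hΩ : ∀ m, IsSemiweight (Ω m)) : TopologicalSpace (beurlingAlgebra Ω hΩ) :=
  (beurlingSeminorm Ω hΩ).moduleFilterBasis.topology

/-! Two complete metrizable vector space topologies on `A` for which all coefficient functionals are
continuous coincide: the identity has closed graph because coefficients separate points. So
everything reduces to automatic continuity of coefficients for an arbitrary Fréchet algebra topology
(`continuous_beurlingCoeff_of_withSeminorms`).

Let `W` be the set of exponents whose coefficient is discontinuous. It is an upper set, and a
gliding hump argument (`exists_eq_zero_of_not_continuous_beurlingCoeff`) shows that every `Ω m`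
vanishes somewhere on each coordinate ray from a point of `W`. By Dickson's lemma `W` then meets
each support in a finite set, so every formal power series supported in `W` lies in `A`.

The space of elements supported in `W` is closed, being cut out by continuous functionals. Inside
it, `∑ X_i • (space)` is the range of a continuous map and has finite codimension, hence is closed
by the open mapping theorem. Iteration allows a single exponent `J + J` to be removed from `W`;
pulling back along multiplication by `X^J` shows that the kernel of the coefficient at `J` is
closed, which contradicts `J ∈ W`. -/

/-! ### Open mapping, closed graph and closed range theorems. -/

section OpenMapping

open Filter Topology Set Function

variable {E F : Type*} [AddCommGroup E] [Module ℂ E] [AddCommGroup F] [Module ℂ F]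

/-- A surjective continuous linear map onto a Baire topological vector space is almost open. -/
theorem closure_image_mem_nhds_zero [TopologicalSpace E] [IsTopologicalAddGroup E]
    [ContinuousSMul ℂ E] [TopologicalSpace F] [IsTopologicalAddGroup F] [ContinuousSMul ℂ F]
    [BaireSpace F] (T : E →L[ℂ] F) (hT : Surjective T) {U : Set E} (hU : U ∈ 𝓝 (0 : E)) :
    closure (T '' U) ∈ 𝓝 (0 : F) := by
  obtain ⟨V, hV, hVU⟩ : ∃ V ∈ 𝓝 (0 : E), ∀ v ∈ V, ∀ w ∈ V, v - w ∈ U := by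
    have h : Tendsto (fun p : E × E => p.1 - p.2) (𝓝 0 ×ˢ 𝓝 0) (𝓝 0) := by
      rw [← nhds_prod_eq]
      exact (continuous_fst.sub continuous_snd).tendsto' _ _ (by simp)
    obtain ⟨V, hV, hVU⟩ := mem_prod_self_iff.1 (h hU)
    exact ⟨V, hV, fun v hv w hw => hVU (mk_mem_prod hv hw)⟩
  have hne : ∀ n : ℕ, ((n : ℂ) + 1) ≠ 0 := fun n => Nat.cast_add_one_ne_zero n
  -- Dilates of `closure (T '' V)` cover `F`, so by Baire one has an interior point `y`. Subtracting
  -- `y` and scaling back turns its neighbourhood into one of zero inside `closure (T '' U)`.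
  obtain ⟨n, y, hy⟩ : ∃ n : ℕ,
      (interior ((fun z : F => ((n : ℂ) + 1)⁻¹ • z) ⁻¹' closure (T '' V))).Nonempty := by
    have : Nonempty F := ⟨0⟩
    refine nonempty_interior_of_iUnion_of_closed
      (fun n => isClosed_closure.preimage (continuous_const_smul _)) ?_
    refine eq_univ_of_forall fun z => ?_
    obtain ⟨x, rfl⟩ := hT z
    have h : Tendsto (fun n : ℕ => ((n : ℂ) + 1)⁻¹ • x) atTop (𝓝 0) := by
      have h1 : Tendsto (fun n : ℕ => ((n : ℂ) + 1)⁻¹) atTop (𝓝 0) := by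
        simpa using tendsto_one_div_add_atTop_nhds_zero_nat (𝕜 := ℂ)
      simpa using h1.smul_const x
    obtain ⟨n, hn⟩ := (h.eventually hV).exists
    exact mem_iUnion.2 ⟨n, subset_closure ⟨_, hn, by simp⟩⟩
  have hO : (fun z : F => y + ((n : ℂ) + 1) • z) ⁻¹'
      interior ((fun z : F => ((n : ℂ) + 1)⁻¹ • z) ⁻¹' closure (T '' V)) ∈ 𝓝 (0 : F) :=
    (continuous_const.add (continuous_const_smul _)).continuousAt.preimage_mem_nhds
      (isOpen_interior.mem_nhds (by simpa using hy))
  refine mem_of_superset hO fun z hz => ?_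
  have h1 := interior_subset hz
  have h2 := interior_subset hy
  simp only [mem_preimage, smul_add, smul_smul, inv_mul_cancel₀ (hne n), one_smul] at h1 h2
  have h3 := map_mem_closure₂ (f := fun a b : F => a - b) (continuous_fst.sub continuous_snd)
    h1 h2 (u := T '' U) (by
      rintro _ ⟨v, hv, rfl⟩ _ ⟨w, hw, rfl⟩
      exact ⟨v - w, hVU v hv w hw, by simp⟩)
  simpa using h3

/-- The open mapping theorem for complete first-countable topological vector spaces. -/
theorem isOpenMap_of_surjective_of_complete [UniformSpace E] [IsUniformAddGroup E]
    [ContinuousSMul ℂ E] [CompleteSpace E] [FirstCountableTopology E]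
    [TopologicalSpace F] [IsTopologicalAddGroup F] [ContinuousSMul ℂ F] [T2Space F]
    [BaireSpace F] (T : E →L[ℂ] F) (hT : Surjective T) : IsOpenMap T := by
  have key : ∀ U ∈ 𝓝 (0 : E), T '' U ∈ 𝓝 (0 : F) := by
    intro U hU
    obtain ⟨u, hu, hadd⟩ := IsTopologicalAddGroup.exists_antitone_basis_nhds_zero E
    obtain ⟨C, ⟨hC, hCc⟩, hCU⟩ := (closed_nhds_basis (0 : E)).mem_iff.1 hU
    obtain ⟨N, hN⟩ := hu.1.mem_iff.1 hC
    have hN' : u N ⊆ C := hN.2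
    have hmem : ∀ n, u n ∈ 𝓝 (0 : E) := fun n => hu.1.mem_of_mem trivial
    have hz : ∀ n, (0 : E) ∈ u n := fun n => mem_of_mem_nhds (hmem n)
    refine mem_of_superset (closure_image_mem_nhds_zero T hT (hmem (N + 1))) fun y hy => ?_
    have step : ∀ n, ∀ y ∈ closure (T '' u n), ∃ x ∈ u n, y - T x ∈ closure (T '' u (n + 1)) := by
      intro n y hy
      have h1 : (fun z => y - z) ⁻¹' closure (T '' u (n + 1)) ∈ 𝓝 y :=
        (continuous_const.sub continuous_id).continuousAt.preimage_mem_nhds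
          (by simpa using closure_image_mem_nhds_zero T hT (hmem (n + 1)))
      obtain ⟨_, hz, x, hx, rfl⟩ := mem_closure_iff_nhds.1 hy _ h1
      exact ⟨x, hx, hz⟩
    choose! X hXu hXc using step
    -- `Y n` is the error left after `n` corrections. Starting at index `N + 1` keeps all partial
    -- sums in `u N`, since `u (n + 1) + u (n + 1) ⊆ u n`; the limit then stays in the closed set
    -- `C`.
    let Y : ℕ → F := fun n => Nat.rec y (fun n z => z - T (X (N + 1 + n) z)) n
    have hY : ∀ n, Y n ∈ closure (T '' u (N + 1 + n)) := by
      intro n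
      induction n with
      | zero => exact hy
      | succ n ih => exact hXc _ _ ih
    let x : ℕ → E := fun n => X (N + 1 + n) (Y n)
    have hx : ∀ n, x n ∈ u (N + 1 + n) := fun n => hXu _ _ (hY n)
    have hsum : ∀ d a, ∑ i ∈ Finset.range d, x (a + i) ∈ u (N + a) := by
      intro d
      induction d with
      | zero => intro a; simpa using hz _
      | succ d ih =>
        intro a
        rw [Finset.sum_range_succ']
        refine hadd (N + a) (Set.add_mem_add ?_ ?_)
        · have := ih (a + 1)
          simpa only [add_assoc, add_comm 1] using this
        · have := hx a
          rw [add_right_comm] at this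
          simpa using this
    let s : ℕ → E := fun n => ∑ i ∈ Finset.range n, x i
    have hTs : ∀ n, T (s n) = y - Y n := by
      intro n
      induction n with
      | zero => simp [s, Y]
      | succ n ih =>
        have : Y (n + 1) = Y n - T (x n) := rfl
        simp only [s] at ih ⊢
        rw [Finset.sum_range_succ, map_add, ih, this]
        abel
    have hcau : CauchySeq s := by
      refine hu.1.uniformity_of_nhds_zero_swapped.cauchySeq_iff'.2 fun n _ => ⟨n, fun m hm => ?_⟩
      obtain ⟨d, rfl⟩ := Nat.exists_eq_add_of_le hm
      have h1 : s (n + d) - s n ∈ u n := by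
        have := hsum d n
        simp only [s, Finset.sum_range_add, add_sub_cancel_left]
        exact hu.2 (by omega) this
      simpa using h1
    obtain ⟨a, ha⟩ := cauchySeq_tendsto_of_complete hcau
    refine ⟨a, hCU (hCc.mem_of_tendsto ha (Eventually.of_forall fun n => hN' ?_)), ?_⟩
    · simpa using hsum n 0
    · have hY0 : Tendsto Y atTop (𝓝 0) := by
        refine (closed_nhds_basis (0 : F)).tendsto_right_iff.2 fun Q ⟨hQ, hQc⟩ => ?_
        have hQ' : T ⁻¹' Q ∈ 𝓝 (0 : E) := T.continuous.continuousAt.preimage_mem_nhds (by simpa)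
        obtain ⟨M, -, hM⟩ := hu.1.mem_iff.1 hQ'
        refine eventually_atTop.2 ⟨M, fun n hn => ?_⟩
        exact closure_minimal (image_subset_iff.2 ((hu.2 (by omega)).trans hM)) hQc (hY n)
      have h1 : Tendsto (fun n => T (s n)) atTop (𝓝 (T a)) := (T.continuous.tendsto a).comp ha
      have h2 : Tendsto (fun n => T (s n)) atTop (𝓝 (y - 0)) := by
        simp only [hTs]
        exact tendsto_const_nhds.sub hY0
      simpa using tendsto_nhds_unique h1 h2
  exact IsTopologicalAddGroup.isOpenMap_iff_nhds_zero.2 fun U hU =>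
    mem_of_superset (key _ hU) (image_preimage_subset _ _)

/-- The closed graph theorem for complete first-countable topological vector spaces. -/
theorem LinearMap.continuous_of_isClosed_graph_of_complete [UniformSpace E] [IsUniformAddGroup E]
    [ContinuousSMul ℂ E] [CompleteSpace E] [FirstCountableTopology E] [T2Space E] [BaireSpace E]
    [UniformSpace F] [IsUniformAddGroup F]
    [ContinuousSMul ℂ F] [CompleteSpace F] [FirstCountableTopology F]
    (T : E →ₗ[ℂ] F) (hT : IsClosed {p : E × F | p.2 = T p.1}) : Continuous T := by
  have hc : IsClosed (T.graph : Set (E × F)) := by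
    convert hT using 1
    ext p
    simp
  have : CompleteSpace T.graph := hc.completeSpace_coe
  have : IsUniformAddGroup T.graph := T.graph.toAddSubgroup.isUniformAddGroup
  have : FirstCountableTopology T.graph :=
    TopologicalSpace.Subtype.firstCountableTopology (T.graph : Set (E × F))
  let P : T.graph →L[ℂ] E := (ContinuousLinearMap.fst ℂ E F).comp T.graph.subtypeL
  have hP : Surjective P := fun x => ⟨⟨(x, T x), by simp⟩, rfl⟩
  -- Preimages under `T` are images under `P` of open subsets of the graph, so openness of `P` is
  -- continuity of `T`.
  have hop := isOpenMap_of_surjective_of_complete P hP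
  refine continuous_def.2 fun O hO => ?_
  convert hop _ (hO.preimage (continuous_snd.comp continuous_subtype_val)) using 1
  ext x
  constructor
  · intro hx
    exact ⟨⟨(x, T x), by simp⟩, hx, rfl⟩
  · rintro ⟨⟨⟨a, b⟩, hab⟩, hb, rfl⟩
    simp only [LinearMap.mem_graph_iff] at hab
    subst hab
    exact hb

/-- A linear map between complete first-countable topological vector spaces is continuous as soon
as its compositions with a separating family of continuous functionals are. -/
theorem LinearMap.continuous_of_forall_continuous_comp [UniformSpace E] [IsUniformAddGroup E]
    [ContinuousSMul ℂ E] [CompleteSpace E] [FirstCountableTopology E] [T2Space E]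
    [UniformSpace F] [IsUniformAddGroup F]
    [ContinuousSMul ℂ F] [CompleteSpace F] [FirstCountableTopology F]
    (T : E →ₗ[ℂ] F) {ι : Type*} (φ : ι → F → ℂ) (hφ : ∀ j, Continuous (φ j))
    (hsep : ∀ x y, (∀ j, φ j x = φ j y) → x = y) (hT : ∀ j, Continuous fun x => φ j (T x)) :
    Continuous T := by
  have : BaireSpace E := by
    have : (uniformity E).IsCountablyGenerated :=
      IsUniformAddGroup.uniformity_countably_generated
    infer_instance
  refine T.continuous_of_isClosed_graph_of_complete ?_
  have : {p : E × F | p.2 = T p.1} = ⋂ j, {p | φ j p.2 = φ j (T p.1)} := by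
    ext p
    simp only [mem_ofPred_eq, mem_iInter]
    exact ⟨fun h j => by rw [h], hsep _ _⟩
  rw [this]
  exact isClosed_iInter fun j => isClosed_eq ((hφ j).comp continuous_snd)
    ((hT j).comp continuous_fst)

/-- The range of a continuous linear map between complete first-countable topological vector
spaces is closed if it has a finite-dimensional algebraic complement in a closed subspace. -/
theorem ContinuousLinearMap.isClosed_range_of_disjoint_finiteDimensional
    [UniformSpace E] [IsUniformAddGroup E]
    [ContinuousSMul ℂ E] [CompleteSpace E] [FirstCountableTopology E]
    [UniformSpace F] [IsUniformAddGroup F] [T2Space F]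
    [ContinuousSMul ℂ F] [CompleteSpace F] [FirstCountableTopology F]
    (T : E →L[ℂ] F) (G M : Submodule ℂ F) [FiniteDimensional ℂ G]
    (hd : Disjoint T.range G) (hM : T.range ⊔ G = M) (hMc : IsClosed (M : Set F)) :
    IsClosed (T.range : Set F) := by
  have : CompleteSpace M := hMc.completeSpace_coe
  have : IsUniformAddGroup M := M.toAddSubgroup.isUniformAddGroup
  have : IsUniformAddGroup G := G.toAddSubgroup.isUniformAddGroup
  have : FirstCountableTopology M := TopologicalSpace.Subtype.firstCountableTopology (M : Set F)
  have : FirstCountableTopology G := TopologicalSpace.Subtype.firstCountableTopology (G : Set F)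
  have : CompleteSpace G := FiniteDimensional.complete ℂ G
  have : BaireSpace M := by
    have : (uniformity M).IsCountablyGenerated :=
      IsUniformAddGroup.uniformity_countably_generated
    infer_instance
  let S : E × G →L[ℂ] M := (T.coprod G.subtypeL).codRestrict M (by
    rintro ⟨e, g⟩
    rw [← hM]
    exact Submodule.add_mem_sup ⟨e, rfl⟩ g.2)
  have hS : Surjective S := by
    rintro ⟨y, hy⟩
    rw [← hM] at hy
    obtain ⟨_, ⟨e, rfl⟩, g, hg, rfl⟩ := Submodule.mem_sup.1 hy
    exact ⟨(e, ⟨g, hg⟩), rfl⟩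
  have hop := isOpenMap_of_surjective_of_complete S hS
  have hO : IsOpen (S '' {p | p.2 ≠ 0}) :=
    hop _ (isOpen_ne_fun continuous_snd continuous_const)
  have hle : T.range ≤ M := hM ▸ le_sup_left
  -- By disjointness the `G`-component of a point of `M` is unique, and the point is in the range
  -- exactly when that component is zero.
  have : ((↑) : M → F) ⁻¹' (T.range : Set F) = (S '' {p | p.2 ≠ 0})ᶜ := by
    ext y
    constructor
    · rintro hy ⟨⟨e, g⟩, hg, rfl⟩
      refine hg (Subtype.ext ?_)
      have h1 : (g : F) ∈ T.range := by
        have h2 : T e + g ∈ T.range := hy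
        simpa using Submodule.sub_mem _ h2 ⟨e, rfl⟩
      exact Submodule.disjoint_def.1 hd _ h1 g.2
    · intro hy
      obtain ⟨⟨e, g⟩, rfl⟩ := hS y
      by_cases hg : g = 0
      · subst hg
        exact ⟨e, by simp [S]⟩
      · exact absurd ⟨(e, g), hg, rfl⟩ hy
  have h1 : IsClosed (((↑) : M → F) ⁻¹' (T.range : Set F)) := by
    rw [this]
    exact hO.isClosed_compl
  have h2 : IsClosed (((↑) : M → F) '' (((↑) : M → F) ⁻¹' (T.range : Set F))) :=
    hMc.isClosedEmbedding_subtypeVal.isClosedMap _ h1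
  rwa [image_preimage_eq_of_subset (fun y hy => ⟨⟨y, hle hy⟩, rfl⟩)] at h2

end OpenMapping

/-! ### Summability and unbounded functionals. -/

section Seminorms

open Filter Topology Set Function

variable {E : Type*} [AddCommGroup E] [Module ℂ E] [UniformSpace E] [IsUniformAddGroup E]

/-- Absolute convergence with respect to every seminorm implies summability. -/
theorem WithSeminorms.summable [CompleteSpace E] {q : SeminormFamily ℂ E ℕ} (hq : WithSeminorms q)
    (hmono : Monotone q) {f : ℕ → E} (hf : ∀ m, Summable fun n => q m (f n)) : Summable f := by
  refine summable_iff_vanishing.2 fun e he => ?_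
  obtain ⟨s, r, hr, hs⟩ := (hq.mem_nhds_iff 0 e).1 he
  have hle : s.sup q ≤ q (s.sup id) := Finset.sup_le fun i hi => hmono (Finset.le_sup (f := id) hi)
  obtain ⟨S, hS⟩ := summable_iff_vanishing_norm.1 (hf (s.sup id)) r hr
  refine ⟨S, fun t ht => hs ?_⟩
  rw [Seminorm.mem_ball_zero]
  refine (hle _).trans_lt ?_
  refine lt_of_le_of_lt ?_ (hS t ht)
  refine le_trans ?_ (le_abs_self _)
  exact Finset.le_sum_of_subadditive _ (map_zero _).le (map_add_le_add _) _ _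

/-- A discontinuous linear functional is unbounded on every neighbourhood of zero. -/
theorem LinearMap.exists_lt_norm_of_not_continuous [ContinuousSMul ℂ E] {φ : E →ₗ[ℂ] ℂ}
    (hφ : ¬ Continuous φ) {U : Set E} (hU : U ∈ 𝓝 (0 : E)) (K : ℝ) : ∃ g ∈ U, K < ‖φ g‖ := by
  by_contra! h
  refine hφ (φ.clmOfExistsBoundedImage ⟨U, hU, ?_⟩).continuous
  rw [NormedSpace.isVonNBounded_iff]
  refine (Metric.isBounded_closedBall (x := (0 : ℂ)) (r := K)).subset ?_
  rintro _ ⟨g, hg, rfl⟩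
  simpa using h g hg

end Seminorms

/-! ### The topology `τ` is a Fréchet algebra topology. -/

section Beurling

open Filter Topology Set Function

/-- A Cauchy product estimate for sums of non-negative families. -/
theorem tsum_le_tsum_mul_tsum_of_le_antidiagonal {A : Type*} [AddCommMonoid A]
    [Finset.HasAntidiagonal A] {F G H : A → ℝ} (hF : Summable F) (hG : Summable G)
    (hF0 : ∀ a, 0 ≤ F a) (hG0 : ∀ a, 0 ≤ G a) (hH : Summable H)
    (hle : ∀ a, H a ≤ ∑ p ∈ Finset.HasAntidiagonal.antidiagonal a, F p.1 * G p.2) :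
    ∑' a, H a ≤ (∑' a, F a) * ∑' a, G a := by
  have hFG := Summable.mul_of_nonneg hF hG hF0 hG0
  rw [hF.tsum_mul_tsum_eq_tsum_sum_antidiagonal hG hFG]
  exact hH.tsum_le_tsum hle (summable_sum_mul_antidiagonal_of_summable_mul hFG)

variable {k : ℕ} {Ω : ℕ → (Fin k →₀ ℕ) → ℝ} {hΩ : ∀ m, IsSemiweight (Ω m)}

/-- The coefficient functional at `J`. -/
noncomputable def beurlingCoeff (hΩ : ∀ m, IsSemiweight (Ω m)) (J : Fin k →₀ ℕ) :
    beurlingAlgebra Ω hΩ →ₗ[ℂ] ℂ :=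
  (MvPowerSeries.coeff J).comp (beurlingAlgebra Ω hΩ).val.toLinearMap

theorem beurling_ext {f g : beurlingAlgebra Ω hΩ}
    (h : ∀ J, beurlingCoeff hΩ J f = beurlingCoeff hΩ J g) : f = g :=
  Subtype.ext (MvPowerSeries.ext h)

theorem summable_beurlingCoeff (f : beurlingAlgebra Ω hΩ) (m : ℕ) :
    Summable fun J => ‖beurlingCoeff hΩ J f‖ * Ω m J :=
  f.2 m

theorem beurlingSeminorm_apply (m : ℕ) (f : beurlingAlgebra Ω hΩ) :
    beurlingSeminorm Ω hΩ m f = ∑' J, ‖beurlingCoeff hΩ J f‖ * Ω m J :=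
  rfl

theorem norm_beurlingCoeff_mul_nonneg (f : beurlingAlgebra Ω hΩ) (m : ℕ) (J : Fin k →₀ ℕ) :
    0 ≤ ‖beurlingCoeff hΩ J f‖ * Ω m J :=
  mul_nonneg (norm_nonneg _) ((hΩ m).nonneg J)

theorem norm_beurlingCoeff_mul_le (f : beurlingAlgebra Ω hΩ) (m : ℕ) (J : Fin k →₀ ℕ) :
    ‖beurlingCoeff hΩ J f‖ * Ω m J ≤ beurlingSeminorm Ω hΩ m f :=
  (summable_beurlingCoeff f m).le_tsum J fun _ _ => norm_beurlingCoeff_mul_nonneg f m _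

/-- A coefficient family meeting each support `{ω_m ≠ 0}` in a finite set defines an element of
the Beurling–Fréchet algebra. -/
def beurlingOfFinite (hΩ : ∀ m, IsSemiweight (Ω m)) (a : (Fin k →₀ ℕ) → ℂ)
    (ha : ∀ m, {J | a J ≠ 0 ∧ Ω m J ≠ 0}.Finite) : beurlingAlgebra Ω hΩ :=
  ⟨a, fun m => summable_of_hasFiniteSupport ((ha m).subset fun J hJ => by
    have h : ‖a J‖ * Ω m J ≠ 0 := hJ
    exact ⟨fun h0 => h (by simp [h0]), fun h0 => h (by simp [h0])⟩)⟩

@[simp]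
theorem beurlingCoeff_ofFinite (a : (Fin k →₀ ℕ) → ℂ)
    (ha : ∀ m, {J | a J ≠ 0 ∧ Ω m J ≠ 0}.Finite) (J : Fin k →₀ ℕ) :
    beurlingCoeff hΩ J (beurlingOfFinite hΩ a ha) = a J :=
  rfl

/-- The monomial `X^L` as an element of the Beurling–Fréchet algebra. -/
noncomputable def beurlingMonomial (hΩ : ∀ m, IsSemiweight (Ω m)) (L : Fin k →₀ ℕ) :
    beurlingAlgebra Ω hΩ :=
  beurlingOfFinite hΩ (fun J => MvPowerSeries.coeff J (MvPowerSeries.monomial L (1 : ℂ)))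
    fun m => (finite_singleton L).subset fun J hJ => by
      classical
      by_contra h
      exact hJ.1 (by rw [MvPowerSeries.coeff_monomial, if_neg (by simpa using h)])

theorem beurlingMonomial_val (L : Fin k →₀ ℕ) :
    (beurlingMonomial hΩ L : MvPowerSeries (Fin k) ℂ) = MvPowerSeries.monomial L 1 :=
  rfl

theorem beurlingCoeff_add_monomial_mul (L J : Fin k →₀ ℕ) (f : beurlingAlgebra Ω hΩ) :
    beurlingCoeff hΩ (L + J) (beurlingMonomial hΩ L * f) = beurlingCoeff hΩ J f := by
  have := MvPowerSeries.coeff_add_monomial_mul (m := L) (n := J)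
    (φ := (f : MvPowerSeries (Fin k) ℂ)) (a := (1 : ℂ))
  rw [one_mul] at this
  exact this

theorem beurlingCoeff_monomial_mul_of_not_le {L J : Fin k →₀ ℕ} (h : ¬ L ≤ J)
    (f : beurlingAlgebra Ω hΩ) :
    beurlingCoeff hΩ J (beurlingMonomial hΩ L * f) = 0 := by
  classical
  have := MvPowerSeries.coeff_monomial_mul (m := J) (n := L)
    (φ := (f : MvPowerSeries (Fin k) ℂ)) (a := (1 : ℂ))
  rw [if_neg h] at this
  exact this

theorem beurlingMonomial_add (L M : Fin k →₀ ℕ) :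
    beurlingMonomial hΩ (L + M) = beurlingMonomial hΩ L * beurlingMonomial hΩ M :=
  Subtype.ext (by
    change MvPowerSeries.monomial (L + M) (1 : ℂ) =
      MvPowerSeries.monomial L 1 * MvPowerSeries.monomial M 1
    rw [MvPowerSeries.monomial_mul_monomial, one_mul])

theorem beurlingMonomial_nsmul (n : ℕ) (L : Fin k →₀ ℕ) :
    beurlingMonomial hΩ (n • L) = beurlingMonomial hΩ L ^ n := by
  induction n with
  | zero => exact Subtype.ext (by simp [beurlingMonomial_val, MvPowerSeries.monomial_zero_one])
  | succ n ih => rw [succ_nsmul, beurlingMonomial_add, ih, pow_succ]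

theorem monotone_beurlingSeminorm (hinc : ∀ m N, Ω m N ≤ Ω (m + 1) N) :
    Monotone (beurlingSeminorm Ω hΩ) := by
  refine monotone_nat_of_le_succ fun m f => ?_
  exact (summable_beurlingCoeff f m).tsum_le_tsum
    (fun J => mul_le_mul_of_nonneg_left (hinc m J) (norm_nonneg _)) (summable_beurlingCoeff f _)

theorem beurlingSeminorm_mul_le (m : ℕ) (f g : beurlingAlgebra Ω hΩ) :
    beurlingSeminorm Ω hΩ m (f * g) ≤ beurlingSeminorm Ω hΩ m f * beurlingSeminorm Ω hΩ m g := by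
  have hf := summable_beurlingCoeff f m
  have hg := summable_beurlingCoeff g m
  have hf0 := norm_beurlingCoeff_mul_nonneg f m
  have hg0 := norm_beurlingCoeff_mul_nonneg g m
  have hfg := summable_beurlingCoeff (f * g) m
  have hle : ∀ J, ‖beurlingCoeff hΩ J (f * g)‖ * Ω m J ≤ ∑ p ∈ Finset.HasAntidiagonal.antidiagonal J,
      (‖beurlingCoeff hΩ p.1 f‖ * Ω m p.1) * (‖beurlingCoeff hΩ p.2 g‖ * Ω m p.2) := by
    intro J
    have hc : beurlingCoeff hΩ J (f * g) =
        ∑ p ∈ Finset.HasAntidiagonal.antidiagonal J, beurlingCoeff hΩ p.1 f * beurlingCoeff hΩ p.2 g :=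
      MvPowerSeries.coeff_mul _ _ _
    rw [hc]
    refine (mul_le_mul_of_nonneg_right (norm_sum_le _ _) ((hΩ m).nonneg J)).trans ?_
    rw [Finset.sum_mul]
    refine Finset.sum_le_sum fun p hp => ?_
    rw [← Finset.HasAntidiagonal.mem_antidiagonal.mp hp, norm_mul, mul_mul_mul_comm]
    exact mul_le_mul_of_nonneg_left ((hΩ m).map_add_le _ _)
      (mul_nonneg (norm_nonneg _) (norm_nonneg _))
  rw [beurlingSeminorm_apply, beurlingSeminorm_apply, beurlingSeminorm_apply]
  exact tsum_le_tsum_mul_tsum_of_le_antidiagonal hf hg hf0 hg0 hfg hle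

theorem withSeminorms_beurlingSeminorm :
    @WithSeminorms ℂ (beurlingAlgebra Ω hΩ) ℕ _ _ _ (beurlingSeminorm Ω hΩ)
      (beurlingTopology Ω hΩ) :=
  @WithSeminorms.mk _ _ _ _ _ _ _ (beurlingTopology Ω hΩ) rfl

theorem continuous_beurlingCoeff (hsep : ∀ N, ∃ m, Ω m N ≠ 0) (J : Fin k →₀ ℕ) :
    Continuous[beurlingTopology Ω hΩ, inferInstance] (beurlingCoeff hΩ J) := by
  let := beurlingTopology Ω hΩ
  have hp := withSeminorms_beurlingSeminorm (hΩ := hΩ)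
  obtain ⟨m, hm⟩ := hsep J
  have hpos : 0 < Ω m J := ((hΩ m).nonneg J).lt_of_ne' hm
  refine WithSeminorms.continuous_normedSpace_rng ℂ hp (beurlingCoeff hΩ J)
    ⟨{m}, NNReal.mk (Ω m J)⁻¹ (by positivity), fun f => ?_⟩
  have := norm_beurlingCoeff_mul_le f m J
  rw [mul_comm, ← le_div_iff₀' hpos] at this
  rw [Finset.sup_singleton]
  simpa [Seminorm.comp_apply, NNReal.smul_def, div_eq_inv_mul] using this

/-- The uniform structure on the Beurling–Fréchet algebra is complete. -/
theorem completeSpace_beurling [u : UniformSpace (beurlingAlgebra Ω hΩ)]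
    [IsUniformAddGroup (beurlingAlgebra Ω hΩ)]
    (hu : u.toTopologicalSpace = beurlingTopology Ω hΩ) (hsep : ∀ N, ∃ m, Ω m N ≠ 0) :
    CompleteSpace (beurlingAlgebra Ω hΩ) := by
  have hp : WithSeminorms (beurlingSeminorm Ω hΩ) := by
    rw [hu]; exact withSeminorms_beurlingSeminorm
  have hc : ∀ J, Continuous (beurlingCoeff hΩ J) := by
    rw [hu]; exact continuous_beurlingCoeff hsep
  have := hp.firstCountableTopology
  have : (uniformity (beurlingAlgebra Ω hΩ)).IsCountablyGenerated :=
    IsUniformAddGroup.uniformity_countably_generated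
  refine UniformSpace.complete_of_cauchySeq_tendsto fun f hf => ?_
  have hJ : ∀ J, ∃ a, Tendsto (fun n => beurlingCoeff hΩ J (f n)) atTop (𝓝 a) := fun J =>
    cauchySeq_tendsto_of_complete
      (hf.map (uniformContinuous_addMonoidHom_of_continuous
        (f := (beurlingCoeff hΩ J).toAddMonoidHom) (hc J)))
  choose a ha using hJ
  have hcau : ∀ m, ∀ ε > 0, ∃ N, ∀ i ≥ N, ∀ j ≥ N, beurlingSeminorm Ω hΩ m (f i - f j) < ε := by
    intro m ε hε
    have h1 : {x | beurlingSeminorm Ω hΩ m x < ε} ∈ 𝓝 (0 : beurlingAlgebra Ω hΩ) :=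
      (hp.continuous_seminorm m).continuousAt.preimage_mem_nhds
        (Iio_mem_nhds (by simpa using hε))
    have h2 : Tendsto (fun p : ℕ × ℕ => f p.1 - f p.2) atTop (𝓝 0) := by
      have h3 := hf.tendsto_uniformity
      rw [uniformity_eq_comap_nhds_zero_swapped, tendsto_comap_iff] at h3
      exact h3
    obtain ⟨⟨N, M⟩, hN⟩ := eventually_atTop.1 (h2.eventually h1)
    exact ⟨max N M, fun i hi j hj => hN (i, j) ⟨(le_max_left _ _).trans hi,
      (le_max_right _ _).trans hj⟩⟩
  -- Finite sums pass to the coefficientwise limit in `j`, and a bound uniform in `s` gives both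
  -- membership of the limit and convergence to it.
  have hfin : ∀ m, ∀ ε > 0, ∃ N, ∀ i ≥ N, ∀ s : Finset (Fin k →₀ ℕ),
      ∑ J ∈ s, ‖beurlingCoeff hΩ J (f i) - a J‖ * Ω m J ≤ ε := by
    intro m ε hε
    obtain ⟨N, hN⟩ := hcau m ε hε
    refine ⟨N, fun i hi s => ?_⟩
    have hlim : Tendsto
        (fun j => ∑ J ∈ s, ‖beurlingCoeff hΩ J (f i) - beurlingCoeff hΩ J (f j)‖ * Ω m J) atTop
        (𝓝 (∑ J ∈ s, ‖beurlingCoeff hΩ J (f i) - a J‖ * Ω m J)) :=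
      tendsto_finsetSum _ fun J _ => ((tendsto_const_nhds.sub (ha J)).norm).mul_const _
    refine le_of_tendsto hlim (eventually_atTop.2 ⟨N, fun j hj => ?_⟩)
    refine le_trans ?_ (hN i hi j hj).le
    simp only [← map_sub]
    exact (summable_beurlingCoeff (f i - f j) m).sum_le_tsum s
      fun J _ => norm_beurlingCoeff_mul_nonneg _ m J
  have hsum : ∀ m, ∀ ε > (0 : ℝ), ∃ N, ∀ i ≥ N,
      Summable fun J => ‖beurlingCoeff hΩ J (f i) - a J‖ * Ω m J := by
    intro m ε hε
    obtain ⟨N, hN⟩ := hfin m ε hε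
    exact ⟨N, fun i hi => summable_of_sum_le
      (fun J => mul_nonneg (norm_nonneg _) ((hΩ m).nonneg J)) (hN i hi)⟩
  have hmem : (show MvPowerSeries (Fin k) ℂ from a) ∈ beurlingAlgebra Ω hΩ := by
    intro m
    obtain ⟨N, hN⟩ := hsum m 1 one_pos
    refine ((hN N le_rfl).add (summable_beurlingCoeff (f N) m)).of_nonneg_of_le
      (fun J => mul_nonneg (norm_nonneg _) ((hΩ m).nonneg J)) fun J => ?_
    rw [← add_mul]
    refine mul_le_mul_of_nonneg_right ?_ ((hΩ m).nonneg J)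
    change ‖a J‖ ≤ _
    have := norm_sub_norm_le (a J) (beurlingCoeff hΩ J (f N))
    rw [norm_sub_rev] at this
    linarith
  refine ⟨⟨_, hmem⟩, (hp.tendsto_nhds_atTop _ _).2 fun m ε hε => ?_⟩
  obtain ⟨N, hN⟩ := hfin m (ε / 2) (half_pos hε)
  refine ⟨N, fun i hi => lt_of_le_of_lt ?_ (half_lt_self hε)⟩
  rw [beurlingSeminorm_apply]
  refine Real.tsum_le_of_sum_le (fun J => norm_beurlingCoeff_mul_nonneg _ m J) fun s => ?_
  exact hN i hi s

theorem isFrechetAlgebraTopology_beurling (hsep : ∀ N, ∃ m, Ω m N ≠ 0)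
    (hinc : ∀ m N, Ω m N ≤ Ω (m + 1) N) :
    IsFrechetAlgebraTopology (beurlingAlgebra Ω hΩ) (beurlingTopology Ω hΩ) := by
  let := beurlingTopology Ω hΩ
  have hp : WithSeminorms (beurlingSeminorm Ω hΩ) := withSeminorms_beurlingSeminorm
  have := hp.topologicalAddGroup
  let u : UniformSpace (beurlingAlgebra Ω hΩ) := IsTopologicalAddGroup.rightUniformSpace _
  have hug : IsUniformAddGroup (beurlingAlgebra Ω hΩ) := isUniformAddGroup_of_addCommGroup
  have := hp.firstCountableTopology
  have : (uniformity (beurlingAlgebra Ω hΩ)).IsCountablyGenerated :=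
    IsUniformAddGroup.uniformity_countably_generated
  have : T1Space (beurlingAlgebra Ω hΩ) := hp.T1_of_separating fun f hf => by
    by_contra! h
    refine hf (beurling_ext fun J => ?_)
    obtain ⟨m, hm⟩ := hsep J
    have := norm_beurlingCoeff_mul_le f m J
    rw [h m] at this
    have hpos : 0 < Ω m J := ((hΩ m).nonneg J).lt_of_ne' hm
    have h0 := le_of_mul_le_mul_right (this.trans (zero_mul _).ge) hpos
    simpa using h0
  exact ⟨UniformSpace.metrizableSpace, ⟨u, rfl, hug, completeSpace_beurling rfl hsep⟩,
    ⟨_, monotone_beurlingSeminorm hinc, beurlingSeminorm_mul_le, hp⟩⟩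

end Beurling

/-! ### Gliding hump: where a coefficient can be discontinuous. -/

section GlidingHump

open Filter Topology Set Function

/-- Multiplication operators are continuous for submultiplicative seminorms. -/
theorem WithSeminorms.continuous_const_mul {A : Type*} [CommRing A] [Algebra ℂ A]
    [TopologicalSpace A] {q : SeminormFamily ℂ A ℕ} (hq : WithSeminorms q)
    (hmul : ∀ m x y, q m (x * y) ≤ q m x * q m y) (a : A) : Continuous fun x => a * x := by
  refine WithSeminorms.continuous_of_isBounded hq hq (LinearMap.mulLeft ℂ a)
    fun m => ⟨{m}, NNReal.mk (q m a) (apply_nonneg _ _), fun x => ?_⟩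
  rw [Finset.sup_singleton]
  exact hmul m a x

variable {k : ℕ} {Ω : ℕ → (Fin k →₀ ℕ) → ℝ} {hΩ : ∀ m, IsSemiweight (Ω m)}

/-- The coefficient at `J` is the one at `L + J` after multiplication by `X^L`. Contrapositively,
exponents with discontinuous coefficient form an upper set. -/
theorem continuous_beurlingCoeff_of_add [TopologicalSpace (beurlingAlgebra Ω hΩ)]
    (hmul : ∀ a : beurlingAlgebra Ω hΩ, Continuous fun x => a * x) {L J : Fin k →₀ ℕ}
    (h : Continuous (beurlingCoeff hΩ (L + J))) : Continuous (beurlingCoeff hΩ J) := by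
  have := h.comp (hmul (beurlingMonomial hΩ L))
  refine this.congr fun f => ?_
  exact beurlingCoeff_add_monomial_mul L J f

/-- If the coefficient functional at `J` is discontinuous for some Fréchet algebra topology, then
each `ω_m` vanishes somewhere on every coordinate ray issued from `J`. -/
theorem exists_eq_zero_of_not_continuous_beurlingCoeff [UniformSpace (beurlingAlgebra Ω hΩ)]
    [IsUniformAddGroup (beurlingAlgebra Ω hΩ)] [CompleteSpace (beurlingAlgebra Ω hΩ)]
    [T2Space (beurlingAlgebra Ω hΩ)] {q : SeminormFamily ℂ (beurlingAlgebra Ω hΩ) ℕ}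
    (hq : WithSeminorms q) (hmono : Monotone q)
    (hmul : ∀ a : beurlingAlgebra Ω hΩ, Continuous fun x => a * x)
    {J : Fin k →₀ ℕ} (hJ : ¬ Continuous (beurlingCoeff hΩ J)) (m : ℕ) (i : Fin k) :
    ∃ N : ℕ, Ω m (Finsupp.single i N + J) = 0 := by
  by_contra! hpos
  have := hq.continuousSMul
  -- The step `J i + 1` forces `L ≰ J`, so no multiple of `x = X^L` has a term at `J`.
  let L : Fin k →₀ ℕ := Finsupp.single i (J i + 1)
  have hLJ : ¬ L ≤ J := fun h => by simpa [L] using h i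
  have hnL : ∀ n : ℕ, n • L = Finsupp.single i (n * (J i + 1)) := fun n => by
    rw [Finsupp.smul_single, smul_eq_mul]
  let x := beurlingMonomial hΩ L
  have hx : ∀ (n : ℕ) f, beurlingCoeff hΩ (n • L + J) (x ^ n * f) = beurlingCoeff hΩ J f := by
    intro n f
    rw [← beurlingMonomial_nsmul]
    exact beurlingCoeff_add_monomial_mul _ _ _
  -- Control of all shifts `j ≤ n`, not only `j = n`, makes every tail series `H n` converge.
  let U : ℕ → Set (beurlingAlgebra Ω hΩ) := fun n =>
    ⋂ j ∈ Finset.range (n + 1), {g | q n (x ^ j * g) < (1 / 2) ^ n}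
  have hU : ∀ n, U n ∈ 𝓝 0 := fun n => (Filter.biInter_finset_mem _).2 fun j _ =>
    ((hq.continuous_seminorm n).comp (hmul (x ^ j))).continuousAt.preimage_mem_nhds
      (Iio_mem_nhds (by simp))
  -- The hump must outweigh the coefficient already accumulated in `s` and leave at least `(Ω m (n •
  -- L + J))⁻¹`.
  have hex : ∀ (n : ℕ) (s : beurlingAlgebra Ω hΩ), ∃ g ∈ U n,
      ‖beurlingCoeff hΩ (n • L + J) s‖ + (Ω m (n • L + J))⁻¹ < ‖beurlingCoeff hΩ J g‖ :=
    fun n s => LinearMap.exists_lt_norm_of_not_continuous hJ (hU n) _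
  choose G hGU hG using hex
  let s : ℕ → beurlingAlgebra Ω hΩ := fun n => Nat.rec 0 (fun n s => s + x ^ n * G n s) n
  let g : ℕ → beurlingAlgebra Ω hΩ := fun n => G n (s n)
  have hs : ∀ n, s (n + 1) = s n + x ^ n * g n := fun _ => rfl
  have hsum : ∀ n, Summable fun l => x ^ l * g (n + l) := by
    intro n
    refine hq.summable hmono fun r => ?_
    refine Summable.of_norm_bounded_eventually_nat summable_geometric_two ?_
    filter_upwards [eventually_ge_atTop r] with l hl
    rw [Real.norm_of_nonneg (apply_nonneg _ _)]
    have h1 : g (n + l) ∈ U (n + l) := hGU _ _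
    have h2 : q (n + l) (x ^ l * g (n + l)) < (1 / 2) ^ (n + l) :=
      mem_iInter₂.1 h1 l (Finset.mem_range.2 (by omega))
    calc q r (x ^ l * g (n + l)) ≤ q (n + l) (x ^ l * g (n + l)) := hmono (by omega) _
      _ ≤ (1 / 2) ^ (n + l) := h2.le
      _ ≤ (1 / 2) ^ l := pow_le_pow_of_le_one (by norm_num) (by norm_num) (by omega)
  let H : ℕ → beurlingAlgebra Ω hΩ := fun n => ∑' l, x ^ l * g (n + l)
  have hH : ∀ n, H n = g n + x * H (n + 1) := by
    intro n
    let T : beurlingAlgebra Ω hΩ →L[ℂ] beurlingAlgebra Ω hΩ := ⟨LinearMap.mulLeft ℂ x, hmul x⟩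
    have h1 : x * H (n + 1) = ∑' l, x * (x ^ l * g (n + 1 + l)) := T.map_tsum (hsum (n + 1))
    rw [h1]
    change ∑' l, x ^ l * g (n + l) = _
    rw [(hsum n).tsum_eq_zero_add, pow_zero, one_mul, add_zero]
    congr 1
    refine tsum_congr fun l => ?_
    rw [pow_succ', mul_assoc, add_right_comm, add_assoc]
  -- Coefficients of an infinite sum cannot be taken termwise here, as continuity is in question.
  -- This exact algebraic identity replaces that: the term of `H 0` at `n • L + J` involves only `s
  -- n` and `g n`.
  have hdecomp : ∀ n, H 0 = s n + x ^ n * H n := by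
    intro n
    induction n with
    | zero => simp [s]
    | succ n ih => rw [ih, hH n, hs, pow_succ]; ring
  have hlarge : ∀ n : ℕ, 1 ≤ ‖beurlingCoeff hΩ (n • L + J) (H 0)‖ * Ω m (n • L + J) := by
    intro n
    have hω : 0 < Ω m (n • L + J) :=
      ((hΩ m).nonneg _).lt_of_ne' (by rw [hnL]; exact hpos _)
    have h1 : beurlingCoeff hΩ (n • L + J) (H 0) =
        beurlingCoeff hΩ (n • L + J) (s n) + beurlingCoeff hΩ J (g n) := by
      rw [hdecomp n, map_add, hx, hH n, map_add, beurlingCoeff_monomial_mul_of_not_le hLJ, add_zero]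
    have h2 := hG n (s n)
    have h3 : (Ω m (n • L + J))⁻¹ ≤ ‖beurlingCoeff hΩ (n • L + J) (H 0)‖ := by
      rw [h1]
      have := norm_sub_le_norm_add (beurlingCoeff hΩ J (g n)) (beurlingCoeff hΩ (n • L + J) (s n))
      rw [add_comm (beurlingCoeff hΩ J (g n))] at this
      have h4 : ‖beurlingCoeff hΩ J (g n)‖ = ‖beurlingCoeff hΩ J (G n (s n))‖ := rfl
      linarith
    rwa [inv_le_iff_one_le_mul₀ hω] at h3
  have hinj : Injective fun n : ℕ => n • L + J := by
    intro a b hab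
    have h1 := DFunLike.congr_fun (add_right_cancel hab) i
    rw [hnL, hnL] at h1
    simpa using h1
  have hlim := ((summable_beurlingCoeff (H 0) m).comp_injective hinj).tendsto_atTop_zero
  have := ge_of_tendsto' hlim hlarge
  linarith

end GlidingHump

/-! ### Closed subspaces of elements with prescribed support. -/

section Supported

open Filter Topology Set Function

variable {k : ℕ} {Ω : ℕ → (Fin k →₀ ℕ) → ℝ} {hΩ : ∀ m, IsSemiweight (Ω m)}

/-- The elements of the Beurling–Fréchet algebra supported in `V`. -/
noncomputable def beurlingSupported (hΩ : ∀ m, IsSemiweight (Ω m)) (V : Set (Fin k →₀ ℕ)) :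
    Submodule ℂ (beurlingAlgebra Ω hΩ) :=
  ⨅ J ∈ Vᶜ, LinearMap.ker (beurlingCoeff hΩ J)

theorem mem_beurlingSupported {V : Set (Fin k →₀ ℕ)} {f : beurlingAlgebra Ω hΩ} :
    f ∈ beurlingSupported hΩ V ↔ ∀ J ∉ V, beurlingCoeff hΩ J f = 0 := by
  simp [beurlingSupported, Submodule.mem_iInf]

theorem isClosed_beurlingSupported [TopologicalSpace (beurlingAlgebra Ω hΩ)]
    {V : Set (Fin k →₀ ℕ)} (h : ∀ J ∉ V, Continuous (beurlingCoeff hΩ J)) :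
    IsClosed (beurlingSupported hΩ V : Set (beurlingAlgebra Ω hΩ)) := by
  have : (beurlingSupported hΩ V : Set (beurlingAlgebra Ω hΩ)) =
      ⋂ J ∈ Vᶜ, beurlingCoeff hΩ J ⁻¹' {0} := by
    ext f
    simp [mem_beurlingSupported]
  rw [this]
  exact isClosed_biInter fun J hJ => isClosed_singleton.preimage (h J hJ)

theorem finiteDimensional_beurlingSupported {V : Set (Fin k →₀ ℕ)} (hV : V.Finite) :
    FiniteDimensional ℂ (beurlingSupported hΩ V) := by
  have := hV.to_subtype
  let φ : beurlingSupported hΩ V →ₗ[ℂ] V → ℂ :=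
    LinearMap.pi fun J => (beurlingCoeff hΩ J).comp (Submodule.subtype _)
  refine FiniteDimensional.of_injective φ fun f g hfg => ?_
  refine Subtype.ext (beurling_ext fun J => ?_)
  by_cases hJ : J ∈ V
  · exact congrFun hfg ⟨J, hJ⟩
  · rw [mem_beurlingSupported.1 f.2 J hJ, mem_beurlingSupported.1 g.2 J hJ]

theorem disjoint_beurlingSupported {U V : Set (Fin k →₀ ℕ)} (h : Disjoint U V) :
    Disjoint (beurlingSupported hΩ U) (beurlingSupported hΩ V) := by
  refine Submodule.disjoint_def.2 fun f hU hV => beurling_ext fun J => ?_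
  by_cases hJ : J ∈ U
  · simpa using mem_beurlingSupported.1 hV J (Set.disjoint_left.1 h hJ)
  · simpa using mem_beurlingSupported.1 hU J hJ

theorem beurlingSupported_mono {U V : Set (Fin k →₀ ℕ)} (h : U ⊆ V) :
    beurlingSupported hΩ U ≤ beurlingSupported hΩ V := fun _ hf =>
  mem_beurlingSupported.2 fun J hJ => mem_beurlingSupported.1 hf J fun hJU => hJ (h hJU)

/-- An element supported in `U ∪ F`, with `F` finite, splits accordingly. -/
theorem beurlingSupported_sup_of_finite {U F : Set (Fin k →₀ ℕ)} (hF : F.Finite) :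
    beurlingSupported hΩ U ⊔ beurlingSupported hΩ F = beurlingSupported hΩ (U ∪ F) := by
  classical
  refine le_antisymm (sup_le (beurlingSupported_mono subset_union_left)
    (beurlingSupported_mono subset_union_right)) fun f hf => ?_
  let g := beurlingOfFinite hΩ (fun J => if J ∈ F then beurlingCoeff hΩ J f else 0) fun m =>
    hF.subset fun J hJ => by
      by_contra h
      exact hJ.1 (if_neg h)
  refine Submodule.mem_sup.2 ⟨f - g, mem_beurlingSupported.2 fun J hJ => ?_, g,
    mem_beurlingSupported.2 fun J hJ => if_neg hJ, sub_add_cancel f g⟩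
  rw [map_sub, beurlingCoeff_ofFinite]
  split_ifs with h
  · exact sub_self _
  · rw [mem_beurlingSupported.1 hf J (by simp [hJ, h]), sub_zero]

/-- The non-minimal elements of an upper set. -/
def aboveMinimal {α : Type*} [Preorder α] (V : Set α) : Set α :=
  {J | ∃ J' ∈ V, J' < J}

theorem aboveMinimal_subset {α : Type*} [Preorder α] {V : Set α} (hV : IsUpperSet V) :
    aboveMinimal V ⊆ V := fun _ ⟨_, h, hlt⟩ => hV hlt.le h

theorem isUpperSet_aboveMinimal {α : Type*} [Preorder α] (V : Set α) :
    IsUpperSet (aboveMinimal V) := fun _ _ hle ⟨J', h, hlt⟩ => ⟨J', h, hlt.trans_le hle⟩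

theorem finite_diff_aboveMinimal {α : Type*} [PartialOrder α] [WellQuasiOrderedLE α] (V : Set α) :
    (V \ aboveMinimal V).Finite :=
  WellQuasiOrderedLE.finite_of_isAntichain fun _ ha _ hb hne hle =>
    hb.2 ⟨_, ha.1, hle.lt_of_ne hne⟩

/-- If `ω` vanishes somewhere on every coordinate ray issued from a point of `W`, then `W` meets
the support of `ω` in a finite set. -/
theorem finite_inter_support {W : Set (Fin k →₀ ℕ)} {ω : (Fin k →₀ ℕ) → ℝ} (hω : IsSemiweight ω)
    (h : ∀ J ∈ W, ∀ i, ∃ N : ℕ, ω (Finsupp.single i N + J) = 0) :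
    {J | J ∈ W ∧ ω J ≠ 0}.Finite := by
  choose! N hN using h
  -- By Dickson's lemma `W` has finitely many minimal exponents `J`. Above `J`, exceeding `N J i + J
  -- i` in some coordinate `i` forces `ω` to vanish by submultiplicativity, so the support lies in
  -- finitely many boxes.
  refine Set.Finite.subset ((finite_diff_aboveMinimal W).biUnion fun J _ =>
    Set.finite_Iic (Finsupp.equivFunOnFinite.symm (N J) + J)) ?_
  rintro L ⟨hL, hL0⟩
  obtain ⟨J, hJL, hJ⟩ := exists_minimal_le_of_wellFoundedLT (· ∈ W) L hL
  refine mem_iUnion₂.2 ⟨J, ⟨hJ.1, fun ⟨J', h1, h2⟩ => hJ.not_lt h1 h2⟩, fun i => ?_⟩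
  by_contra! hlt
  refine hL0 (le_antisymm ?_ (hω.nonneg L))
  have hle : Finsupp.single i (N J i) + J ≤ L := by
    intro j
    by_cases hij : i = j
    · subst hij
      simpa using hlt.le
    · simpa [Finsupp.single_apply, hij] using hJL j
  calc ω L = ω ((Finsupp.single i (N J i) + J) + (L - (Finsupp.single i (N J i) + J))) := by
        rw [add_tsub_cancel_of_le hle]
    _ ≤ ω (Finsupp.single i (N J i) + J) * _ := hω.map_add_le _ _
    _ = 0 := by rw [hN J hJ.1 i, zero_mul]

variable [UniformSpace (beurlingAlgebra Ω hΩ)] [IsUniformAddGroup (beurlingAlgebra Ω hΩ)]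
  [ContinuousSMul ℂ (beurlingAlgebra Ω hΩ)] [CompleteSpace (beurlingAlgebra Ω hΩ)]
  [FirstCountableTopology (beurlingAlgebra Ω hΩ)] [T2Space (beurlingAlgebra Ω hΩ)]

/-- Removing the minimal exponents preserves closedness of the space of elements supported in an
upper set on which every power series belongs to the algebra. -/
theorem isClosed_beurlingSupported_aboveMinimal
    (hmul : ∀ a : beurlingAlgebra Ω hΩ, Continuous fun x => a * x) {V : Set (Fin k →₀ ℕ)}
    (hV : IsUpperSet V) (hfin : ∀ m, {J | J ∈ V ∧ Ω m J ≠ 0}.Finite)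
    (hc : IsClosed (beurlingSupported hΩ V : Set (beurlingAlgebra Ω hΩ))) :
    IsClosed (beurlingSupported hΩ (aboveMinimal V) : Set (beurlingAlgebra Ω hΩ)) := by
  classical
  let M := beurlingSupported hΩ V
  have : CompleteSpace M := hc.completeSpace_coe
  have : IsUniformAddGroup M := M.toAddSubgroup.isUniformAddGroup
  have : FirstCountableTopology M := TopologicalSpace.Subtype.firstCountableTopology
    (M : Set (beurlingAlgebra Ω hΩ))
  let x : Fin k → beurlingAlgebra Ω hΩ := fun i => beurlingMonomial hΩ (Finsupp.single i 1)
  let mulL : beurlingAlgebra Ω hΩ → beurlingAlgebra Ω hΩ →L[ℂ] beurlingAlgebra Ω hΩ :=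
    fun a => ⟨LinearMap.mulLeft ℂ a, hmul a⟩
  let T : (Fin k → M) →L[ℂ] beurlingAlgebra Ω hΩ :=
    ∑ i, ((mulL (x i)).comp M.subtypeL).comp (ContinuousLinearMap.proj i)
  have hT : ∀ g, T g = ∑ i, x i * (g i : beurlingAlgebra Ω hΩ) := by
    intro g
    simp [T, mulL]
    rfl
  have hrange : T.range = beurlingSupported hΩ (aboveMinimal V) := by
    refine le_antisymm ?_ fun f hf => ?_
    · rintro _ ⟨g, rfl⟩
      refine mem_beurlingSupported.2 fun J hJ => ?_
      change beurlingCoeff hΩ J (T g) = 0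
      rw [hT, map_sum]
      refine Finset.sum_eq_zero fun i _ => ?_
      by_cases hle : Finsupp.single i 1 ≤ J
      · obtain ⟨L, rfl⟩ := le_iff_exists_add.1 hle
        rw [beurlingCoeff_add_monomial_mul]
        refine mem_beurlingSupported.1 (g i).2 L fun hL => hJ ⟨L, hL, ?_⟩
        refine lt_of_le_of_ne (by simp) fun h => ?_
        simpa using DFunLike.congr_fun h i
      · exact beurlingCoeff_monomial_mul_of_not_le hle _
    -- Each term of `f` is assigned to one variable dividing it with quotient still supported in
    -- `V`. The resulting series lie in the algebra without any estimate, by `hfin`.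
    · have hex : ∀ J ∈ aboveMinimal V, ∃ i, ∃ L ∈ V, Finsupp.single i 1 + L = J := by
        rintro J ⟨J', hJ', hlt⟩
        obtain ⟨i, hi⟩ := (Finsupp.lt_def.1 hlt).2
        have hle : Finsupp.single i 1 ≤ J := by
          simpa using (by omega : 1 ≤ J i)
        refine ⟨i, J - Finsupp.single i 1, hV (fun j => ?_) hJ', add_tsub_cancel_of_le hle⟩
        have := hlt.le j
        by_cases hij : i = j
        · subst hij
          simp
          omega
        · simpa [Finsupp.single_apply, hij] using this
      -- The total function `ι` below needs a default value in `Fin k`, which may be empty.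
      obtain hemp | ⟨J₀, hJ₀⟩ := (aboveMinimal V).eq_empty_or_nonempty
      · have : f = 0 := beurling_ext fun J => by
          rw [mem_beurlingSupported.1 hf J (by simp [hemp]), map_zero]
        exact this ▸ Submodule.zero_mem _
      have : Nonempty (Fin k) := ⟨(hex J₀ hJ₀).choose⟩
      choose! ι hι using hex
      let a : Fin k → (Fin k →₀ ℕ) → ℂ := fun i L =>
        if Finsupp.single i 1 + L ∈ aboveMinimal V ∧ ι (Finsupp.single i 1 + L) = i then
          beurlingCoeff hΩ (Finsupp.single i 1 + L) f else 0
      have ha : ∀ i, ∀ L ∉ V, a i L = 0 := by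
        intro i L hL
        refine if_neg fun ⟨h1, h2⟩ => hL ?_
        obtain ⟨L', hL', h3⟩ := hι _ h1
        rw [h2] at h3
        rwa [← add_left_cancel h3]
      let g : Fin k → M := fun i => ⟨beurlingOfFinite hΩ (a i) fun m =>
        (hfin m).subset fun L hL => ⟨by_contra fun h => hL.1 (ha i L h), hL.2⟩,
        mem_beurlingSupported.2 fun L hL => ha i L hL⟩
      refine ⟨g, ?_⟩
      change T g = f
      have hcoeff : ∀ J i, beurlingCoeff hΩ J (x i * (g i : beurlingAlgebra Ω hΩ)) =
          if ι J = i then (if J ∈ aboveMinimal V then beurlingCoeff hΩ J f else 0) else 0 := by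
        intro J i
        rw [← ite_and]
        by_cases hle : Finsupp.single i 1 ≤ J
        · obtain ⟨L, rfl⟩ := le_iff_exists_add.1 hle
          rw [beurlingCoeff_add_monomial_mul]
          change a i L = _
          simp only [a, and_comm]
        · rw [beurlingCoeff_monomial_mul_of_not_le hle, if_neg]
          rintro ⟨h1, h2⟩
          obtain ⟨L, -, h3⟩ := hι J h2
          rw [h1] at h3
          exact hle (h3 ▸ le_self_add)
      refine beurling_ext fun J => ?_
      rw [hT, map_sum, Finset.sum_congr rfl fun i _ => hcoeff J i, Finset.sum_ite_eq,
        if_pos (Finset.mem_univ _)]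
      split_ifs with h
      · rfl
      · exact (mem_beurlingSupported.1 hf J h).symm
  have hFin := finite_diff_aboveMinimal V
  have := finiteDimensional_beurlingSupported (hΩ := hΩ) hFin
  -- The finitely many minimal exponents of `V` span the complement of the range in `M`.
  have key := ContinuousLinearMap.isClosed_range_of_disjoint_finiteDimensional
    (E := Fin k → M) (F := beurlingAlgebra Ω hΩ) T (beurlingSupported hΩ (V \ aboveMinimal V)) M
    (by rw [hrange]; exact disjoint_beurlingSupported disjoint_sdiff_self_right)
    (by rw [hrange, beurlingSupported_sup_of_finite hFin,
          union_sdiff_cancel (aboveMinimal_subset hV)]) hc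
  rwa [hrange] at key

/-- Under the same hypotheses, removing a single exponent from `V` preserves closedness. -/
theorem isClosed_beurlingSupported_diff_singleton
    (hmul : ∀ a : beurlingAlgebra Ω hΩ, Continuous fun x => a * x) {V : Set (Fin k →₀ ℕ)}
    (hV : IsUpperSet V) (hfin : ∀ m, {J | J ∈ V ∧ Ω m J ≠ 0}.Finite)
    (hc : IsClosed (beurlingSupported hΩ V : Set (beurlingAlgebra Ω hΩ))) (J : Fin k →₀ ℕ) :
    IsClosed (beurlingSupported hΩ (V \ {J}) : Set (beurlingAlgebra Ω hΩ)) := by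
  have main : ∀ n : ℕ, ∃ U ⊆ V, IsUpperSet U ∧ (V \ U).Finite ∧ (∀ L ∈ U, n ≤ L.degree) ∧
      IsClosed (beurlingSupported hΩ U : Set (beurlingAlgebra Ω hΩ)) := by
    intro n
    induction n with
    | zero => exact ⟨V, subset_rfl, hV, by simp, by simp, hc⟩
    | succ n ih =>
      obtain ⟨U, hUV, hU, hF, hdeg, hUc⟩ := ih
      refine ⟨aboveMinimal U, (aboveMinimal_subset hU).trans hUV, isUpperSet_aboveMinimal U, ?_,
        ?_, isClosed_beurlingSupported_aboveMinimal hmul hU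
          (fun m => (hfin m).subset fun L hL => ⟨hUV hL.1, hL.2⟩) hUc⟩
      · refine (hF.union (finite_diff_aboveMinimal U)).subset fun L hL => ?_
        by_cases h : L ∈ U
        · exact Or.inr ⟨h, hL.2⟩
        · exact Or.inl ⟨hL.1, h⟩
      · rintro L ⟨L', hL', hlt⟩
        have h1 := hdeg L' hL'
        obtain ⟨D, rfl⟩ := le_iff_exists_add.1 hlt.le
        have h2 : D.degree ≠ 0 := fun h0 => by
          rw [Finsupp.degree_eq_zero_iff] at h0
          simp [h0] at hlt
        rw [map_add]
        omega
  -- Each removal of minimal exponents raises the least degree, so `J` is gone after `J.degree + 1`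
  -- rounds; the other exponents lost are finitely many and can be put back.
  obtain ⟨U, hUV, -, hF, hdeg, hUc⟩ := main (J.degree + 1)
  have hJU : J ∉ U := fun h => by have := hdeg J h; omega
  have hF' : ((V \ U) \ {J}).Finite := hF.subset sdiff_subset
  have hEq : U ∪ ((V \ U) \ {J}) = V \ {J} := by
    ext L
    by_cases h : L ∈ U
    · have : L ≠ J := fun h' => hJU (h' ▸ h)
      simp [h, hUV h, this]
    · simp [h]
  have := finiteDimensional_beurlingSupported (hΩ := hΩ) hF'
  rw [← hEq, ← beurlingSupported_sup_of_finite hF']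
  exact Submodule.isClosed_sup_finiteDimensional _ _ hUc

/-- Coefficient functionals are continuous for every Fréchet algebra topology. -/
theorem continuous_beurlingCoeff_of_withSeminorms {q : SeminormFamily ℂ (beurlingAlgebra Ω hΩ) ℕ}
    (hq : WithSeminorms q) (hmono : Monotone q)
    (hmul : ∀ a : beurlingAlgebra Ω hΩ, Continuous fun x => a * x) (J : Fin k →₀ ℕ) :
    Continuous (beurlingCoeff hΩ J) := by
  let W : Set (Fin k →₀ ℕ) := {J | ¬ Continuous (beurlingCoeff hΩ J)}
  have hW : IsUpperSet W := by
    intro L L' hle hL h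
    obtain ⟨D, rfl⟩ := le_iff_exists_add'.1 hle
    exact hL (continuous_beurlingCoeff_of_add hmul h)
  have hfin : ∀ m, {J | J ∈ W ∧ Ω m J ≠ 0}.Finite := fun m =>
    finite_inter_support (hΩ m) fun L hL i =>
      exists_eq_zero_of_not_continuous_beurlingCoeff hq hmono hmul hL m i
  have hc : IsClosed (beurlingSupported hΩ W : Set (beurlingAlgebra Ω hΩ)) :=
    isClosed_beurlingSupported fun L hL => not_not.1 hL
  by_contra hJ
  -- Multiplication by `X^J` maps the whole algebra into the elements supported in `W`, moving the
  -- coefficient at `J` to `J + J`. Removing `J + J` thus yields the full kernel, not just its part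
  -- supported in `W`.
  have hcl := (isClosed_beurlingSupported_diff_singleton hmul hW hfin hc (J + J)).preimage
    (hmul (beurlingMonomial hΩ J))
  refine hJ ((LinearMap.continuous_iff_isClosed_ker _).2 ?_)
  convert hcl using 1
  ext f
  simp only [SetLike.mem_coe, LinearMap.mem_ker, mem_preimage, mem_beurlingSupported]
  constructor
  · intro hf L hL
    by_cases hle : J ≤ L
    · have hLW : L ∈ W := hW hle hJ
      have : L = J + J := by
        by_contra hne
        exact hL ⟨hLW, hne⟩
      rw [this, beurlingCoeff_add_monomial_mul, hf]
    · exact beurlingCoeff_monomial_mul_of_not_le hle f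
  · intro h
    rw [← beurlingCoeff_add_monomial_mul J J f]
    exact h _ fun h => h.2 rfl

end Supported

/-! ### Comparison of two Fréchet algebra topologies. -/

section Uniqueness

open Filter Topology Set Function

variable {k : ℕ} {Ω : ℕ → (Fin k →₀ ℕ) → ℝ} {hΩ : ∀ m, IsSemiweight (Ω m)}

theorem IsFrechetAlgebraTopology.continuous_beurlingCoeff
    {t : TopologicalSpace (beurlingAlgebra Ω hΩ)}
    (ht : IsFrechetAlgebraTopology (beurlingAlgebra Ω hΩ) t) (J : Fin k →₀ ℕ) :
    Continuous (beurlingCoeff hΩ J) := by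
  obtain ⟨hmet, ⟨u, rfl, _, _⟩, q, hmono, hmul, hq⟩ := ht
  have := hq.continuousSMul
  have := hq.firstCountableTopology
  exact continuous_beurlingCoeff_of_withSeminorms hq hmono (hq.continuous_const_mul hmul) J

/-- A Fréchet algebra topology comes from a complete first-countable vector space uniformity. -/
theorem IsFrechetAlgebraTopology.exists_uniformSpace {A : Type*} [CommRing A] [Algebra ℂ A]
    {t : TopologicalSpace A} (ht : IsFrechetAlgebraTopology A t) :
    ∃ u : UniformSpace A, u.toTopologicalSpace = t ∧ IsUniformAddGroup A ∧ CompleteSpace A ∧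
      ContinuousSMul ℂ A ∧ FirstCountableTopology A ∧ T2Space A := by
  obtain ⟨hmet, ⟨u, rfl, hu, hc⟩, q, -, -, hq⟩ := ht
  have := hq.topologicalAddGroup
  exact ⟨u, rfl, hu, hc, hq.continuousSMul, hq.firstCountableTopology, inferInstance⟩

/-- Every Fréchet algebra topology on the Beurling–Fréchet algebra is finer than every other. -/
theorem IsFrechetAlgebraTopology.le_beurling {t t' : TopologicalSpace (beurlingAlgebra Ω hΩ)}
    (ht : IsFrechetAlgebraTopology (beurlingAlgebra Ω hΩ) t)
    (ht' : IsFrechetAlgebraTopology (beurlingAlgebra Ω hΩ) t') : t ≤ t' := by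
  have hc := ht.continuous_beurlingCoeff
  have hc' := ht'.continuous_beurlingCoeff
  obtain ⟨u, rfl, h1, h2, h3, h4, h5⟩ := ht.exists_uniformSpace
  obtain ⟨u', rfl, h1', h2', h3', h4', -⟩ := ht'.exists_uniformSpace
  exact continuous_id_iff_le.1
    (@LinearMap.continuous_of_forall_continuous_comp _ _ _ _ _ _ u h1 h3 h2 h4 h5 u' h1' h3' h2' h4'
      LinearMap.id _ (fun J => beurlingCoeff hΩ J) hc' (fun _ _ => beurling_ext) hc)

end Uniqueness

theorem theorem4p2 {k : ℕ} (Ω : ℕ → (Fin k →₀ ℕ) → ℝ) (hΩ : IsSemiweightTypeSequence Ω) :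
    IsFrechetAlgebraTopology (beurlingAlgebra Ω fun m => (hΩ.proper m).1)
        (beurlingTopology Ω fun m => (hΩ.proper m).1) ∧
      ∀ τ' : TopologicalSpace (beurlingAlgebra Ω fun m => (hΩ.proper m).1),
        IsFrechetAlgebraTopology (beurlingAlgebra Ω fun m => (hΩ.proper m).1) τ' →
          τ' = beurlingTopology Ω fun m => (hΩ.proper m).1 := by
  have hτ : IsFrechetAlgebraTopology (beurlingAlgebra Ω fun m => (hΩ.proper m).1)
      (beurlingTopology Ω fun m => (hΩ.proper m).1) :=
    isFrechetAlgebraTopology_beurling hΩ.separating hΩ.increasing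
  exact ⟨hτ, fun τ' hτ' => le_antisymm (hτ'.le_beurling hτ) (hτ.le_beurling hτ')⟩
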